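/- Let $d\ge 2$ and $0\le r_0<r_1\le\infty$, and let $A(r_0,r_1)=\{x\in\mathbb{R}^d: r_0<|x|<r_1\}$. For each $k\in\mathbb{N}_0$ let $Y_{k,l}$, $l=1,\dots,a_k$, be a basis of the $a_k$-dimensional complex vector space of harmonic homogeneous polynomials of degree $k$ on $\mathbb{R}^d$ that is orthonormal with respect to $\langle g,h\rangle=\int_{\mathbb{S}^{d-1}}g(\theta)\overline{h(\theta)}\,d\theta$, where $d\theta$ is the surface measure on the unit sphere $\mathbb{S}^{d-1}$, and let $\omega_{d-1}$ be the surface area of $\mathbb{S}^{d-1}$. Let $\tau\ge 0$ and let $f:A(r_0,r_1)\to\mathbb{C}$ be polyharmonic of infinite order and type $\tau$; that is, $f$ is $C^\infty$ and for every compact $K\subset A(r_0,r_1)$ and every $\varepsilon>0$ there is a constant $C_{K,\varepsilon}>0$ such that $\max_{x\in K}|\Delta^p f(x)|\le C_{K,\varepsilon}\,(2p)!\,(\tau+\varepsilon)^{2p}$ for all $p\in\mathbb{N}_0$. Define its Fourier--Laplace coefficients by $$f_{k,l}(r)=\int_{\mathbb{S}^{d-1}}f(r\theta)\,\overline{Y_{k,l}(\theta)}\,d\theta,\qquad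 r\in(r_0,r_1),$$ and let $$L_k=\frac{d^2}{dr^2}+\frac{d-1}{r}\frac{d}{dr}-\frac{k(k+d-2)}{r^2}.$$ Then every $f_{k,l}$ is $C^\infty$ on $(r_0,r_1)$, and for every interval $[a,b]\subset(r_0,r_1)$ and every $\varepsilon>0$ there is a constant $C_{a,b,\varepsilon}>0$ such that, for all $k\in\mathbb{N}_0$, all $l=1,\dots,a_k$, all $r\in[a,b]$ and all $p\in\mathbb{N}_0$, $$\left|L_k^p(f_{k,l})(r)\right|\le C_{a,b,\varepsilon}\,\sqrt{\omega_{d-1}}\,(2p)!\,(\tau+\varepsilon)^{2p}.$$ -/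

import Mathlib

open MeasureTheory
open scoped ContDiff

noncomputable section

namespace Polyharmonic

/-- `ℝ^d` with its Euclidean norm. -/
abbrev Euc (d : ℕ) : Type := EuclideanSpace ℝ (Fin d)

/-- The open interval `(r₀, r₁)`, where `r₁ = ∞` is allowed. -/
def radii (r₀ : ℝ) (r₁ : EReal) : Set ℝ := {r | r₀ < r ∧ (r : EReal) < r₁}

/-- The annular region `A(r₀, r₁) = {x ∈ ℝ^d : r₀ < |x| < r₁}`. -/
def annulus (d : ℕ) (r₀ : ℝ) (r₁ : EReal) : Set (Euc d) := {x | ‖x‖ ∈ radii r₀ r₁}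

/-- `f` is polyharmonic of infinite order and type `τ` on the open set `G`: it is `C^∞` on `G`,
and for every compact `K ⊆ G` and every `ε > 0` there is `C > 0` with
`|Δ^p f| ≤ C (2p)! (τ + ε)^(2p)` on `K` for all `p`.
Only the values of `f` on `G` matter, because `G` is open. -/
def IsPolyharmonicInf {d : ℕ} (G : Set (Euc d)) (τ : ℝ) (f : Euc d → ℂ) : Prop :=
  ContDiffOn ℝ ∞ f G ∧
    ∀ K : Set (Euc d), IsCompact K → K ⊆ G → ∀ ε : ℝ, 0 < ε →
      ∃ C : ℝ, 0 < C ∧ ∀ p : ℕ, ∀ x ∈ K,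
        ‖((fun g : Euc d → ℂ => Laplacian.laplacian g)^[p] f) x‖
          ≤ C * ((2 * p).factorial : ℝ) * (τ + ε) ^ (2 * p)

/-- The surface measure `dθ` on the unit sphere `S^(d-1)`. -/
def sphereMeasure (d : ℕ) : Measure (Metric.sphere (0 : Euc d) 1) :=
  (volume : Measure (Euc d)).toSphere

/-- The surface area `ω_(d-1)` of `S^(d-1)`. -/
def sphereArea (d : ℕ) : ℝ := (sphereMeasure d).real Set.univ

/-- The Laplacian `∑ i, ∂²/∂x_i²` on polynomials. -/
def polyLaplacian (d : ℕ) : MvPolynomial (Fin d) ℂ →ₗ[ℂ] MvPolynomial (Fin d) ℂ :=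
  ∑ i : Fin d, (MvPolynomial.pderiv i).toLinearMap ∘ₗ (MvPolynomial.pderiv i).toLinearMap

/-- The space of harmonic homogeneous polynomials of degree `k` in `d` variables. -/
def harmonicPoly (d k : ℕ) : Submodule ℂ (MvPolynomial (Fin d) ℂ) :=
  MvPolynomial.homogeneousSubmodule (Fin d) ℂ k ⊓ LinearMap.ker (polyLaplacian d)

/-- `a_k`, the dimension of the space of harmonic homogeneous polynomials of degree `k`. -/
def harmonicDim (d k : ℕ) : ℕ := Module.finrank ℂ (harmonicPoly d k)

/-- The value of a complex polynomial at a point of `ℝ^d`. -/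
def evalAt {d : ℕ} (P : MvPolynomial (Fin d) ℂ) (x : Euc d) : ℂ :=
  MvPolynomial.eval (fun i => ((x i : ℝ) : ℂ)) P

/-- For every `k`, the family `Y k l`, `l = 1, …, a_k` (indexed here by `Fin a_k`), is an
orthonormal basis of the harmonic homogeneous polynomials of degree `k` with respect to
`⟨f, g⟩ = ∫ f(θ) conj (g(θ)) dθ` over the unit sphere. -/
structure IsSphericalBasis (d : ℕ)
    (Y : (k : ℕ) → Fin (harmonicDim d k) → MvPolynomial (Fin d) ℂ) : Prop where
  span_eq : ∀ k, Submodule.span ℂ (Set.range (Y k)) = harmonicPoly d k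
  orthonormal : ∀ k (l m : Fin (harmonicDim d k)),
    ∫ θ, evalAt (Y k l) (θ : Euc d) * (starRingEnd ℂ) (evalAt (Y k m) (θ : Euc d))
      ∂(sphereMeasure d) = if l = m then 1 else 0

/-- The Fourier–Laplace coefficient `r ↦ ∫ f(rθ) conj (P(θ)) dθ` of `f` with respect to `P`;
for `P = Y_{k,l}` this is `f_{k,l}`. -/
def flCoeff {d : ℕ} (f : Euc d → ℂ) (P : MvPolynomial (Fin d) ℂ) (r : ℝ) : ℂ :=
  ∫ θ, f (r • (θ : Euc d)) * (starRingEnd ℂ) (evalAt P (θ : Euc d)) ∂(sphereMeasure d)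

/-- The operator `L_k = d²/dr² + ((d-1)/r) d/dr - k(k+d-2)/r²`. -/
def radialOp (d k : ℕ) (g : ℝ → ℂ) (r : ℝ) : ℂ :=
  deriv (deriv g) r + (((d : ℝ) - 1) / r : ℝ) * deriv g r
    - ((k : ℝ) * ((k : ℝ) + (d : ℝ) - 2) / r ^ 2 : ℝ) * g r

end Polyharmonic

end

/-! The key is the intertwining relation L_k f_{k,l} = (Δf)_{k,l} (`radialOp_flCoeff`). Iterated, it
turns L_k^p f_{k,l} into the coefficient of Δ^p f. By Cauchy–Schwarz on the sphere and the
normalisation of Y_{k,l}, this coefficient at r is at most √ω_{d-1} times any bound of |Δ^p f| on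
|x| = r. The growth condition on the compact shell a ≤ |x| ≤ b then supplies a constant that does
not depend on k and l.

The relation is proved weakly, avoiding the spherical Laplacian. Let Q be the conjugate of P, ψ a
radial test function supported in (0, ∞), and integrate the divergence of ψ(|x|)(Q∇f - f∇Q) over
ℝ^d: the integral is 0. Harmonicity of P removes fΔQ, and Euler's identity turns x·∇Q into kQ. In
polar coordinates, with F and G the coefficients of f and Δf and m = d - 2 + k, this says ∫ ψ
r^(m+1) G + ψ' (r^(m+1) F' - k r^m F) = 0. Hence (r^(m+1) F' - k r^m F)' = r^(m+1) G, and the left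
side is r^(m+1) L_k F.

This argument needs f smooth on all of ℝ^d. A radial cutoff reduces the annulus to that case, since
L_k F at r depends only on f near |x| = r. -/

namespace Polyharmonic

open Set Filter Topology

/-! ### Conjugated polynomials: derivatives, homogeneity, harmonicity -/

/-- The conjugate of the value of a complex polynomial at a point of `ℝ^d`. -/
noncomputable def conjEval {d : ℕ} (P : MvPolynomial (Fin d) ℂ) (x : Euc d) : ℂ :=
  (starRingEnd ℂ) (evalAt P x)

lemma conjEval_add {d : ℕ} (P Q : MvPolynomial (Fin d) ℂ) :
    conjEval (P + Q) = fun x => conjEval P x + conjEval Q x := by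
  ext x; simp [conjEval, evalAt]

lemma conjEval_mul {d : ℕ} (P Q : MvPolynomial (Fin d) ℂ) :
    conjEval (P * Q) = fun x => conjEval P x * conjEval Q x := by
  ext x; simp [conjEval, evalAt]

lemma conjEval_X {d : ℕ} (i : Fin d) :
    conjEval (MvPolynomial.X i) = fun x : Euc d => ((x i : ℝ) : ℂ) := by
  ext x; simp [conjEval, evalAt]

lemma conjEval_C {d : ℕ} (a : ℂ) :
    conjEval (MvPolynomial.C a) = fun _ : Euc d => (starRingEnd ℂ) a := by
  ext x; simp [conjEval, evalAt]

lemma hasFDerivAt_coord {d : ℕ} (i : Fin d) (x : Euc d) :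
    HasFDerivAt (fun x : Euc d => ((x i : ℝ) : ℂ))
      (Complex.ofRealCLM ∘L (EuclideanSpace.proj i : Euc d →L[ℝ] ℝ)) x :=
  (Complex.ofRealCLM ∘L (EuclideanSpace.proj i : Euc d →L[ℝ] ℝ)).hasFDerivAt

lemma contDiff_conjEval {d : ℕ} (P : MvPolynomial (Fin d) ℂ) : ContDiff ℝ ∞ (conjEval P) := by
  induction P using MvPolynomial.induction_on with
  | C a => rw [conjEval_C]; exact contDiff_const
  | add P Q hP hQ => rw [conjEval_add]; exact hP.add hQ
  | mul_X P i hP =>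
    rw [conjEval_mul, conjEval_X]
    exact hP.mul (Complex.ofRealCLM ∘L (EuclideanSpace.proj i : Euc d →L[ℝ] ℝ)).contDiff

lemma fderiv_conjEval_single {d : ℕ} (P : MvPolynomial (Fin d) ℂ) (i : Fin d) (x : Euc d) :
    fderiv ℝ (conjEval P) x (EuclideanSpace.single i 1) =
      conjEval (MvPolynomial.pderiv i P) x := by
  have hd (Q : MvPolynomial (Fin d) ℂ) : DifferentiableAt ℝ (conjEval Q) x :=
    (contDiff_conjEval Q).differentiable (by simp) x
  induction P using MvPolynomial.induction_on with
  | C a => simp [conjEval_C, conjEval, evalAt]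
  | add P Q hP hQ =>
    rw [conjEval_add, fderiv_fun_add (hd P) (hd Q), map_add, conjEval_add]
    simp [hP, hQ]
  | mul_X P j hP =>
    rw [conjEval_mul, fderiv_fun_mul (hd P) (hd _), Derivation.leibniz, conjEval_add]
    simp only [smul_eq_mul, conjEval_mul, ← hP, MvPolynomial.pderiv_X]
    rw [conjEval_X, (hasFDerivAt_coord j x).fderiv]
    by_cases hij : i = j
    · subst hij
      simp [conjEval, evalAt]
    · simp [conjEval, evalAt, Ne.symm hij]

lemma conjEval_smul {d k : ℕ} {P : MvPolynomial (Fin d) ℂ} (hP : P.IsHomogeneous k) (r : ℝ)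
    (x : Euc d) : conjEval P (r • x) = (r : ℂ) ^ k * conjEval P x := by
  have : evalAt P (r • x) = (r : ℂ) ^ k * evalAt P x := by
    unfold evalAt
    rw [MvPolynomial.eval_eq, MvPolynomial.eval_eq, Finset.mul_sum]
    refine Finset.sum_congr rfl fun s hs => ?_
    have hk : ∑ i ∈ s.support, s i = k := by
      have := hP (MvPolynomial.mem_support_iff.1 hs)
      simpa [Finsupp.weight_apply, Finsupp.sum] using this
    simp only [PiLp.smul_apply, smul_eq_mul, Complex.ofReal_mul, mul_pow, Finset.prod_mul_distrib,
      Finset.prod_pow_eq_pow_sum, hk]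
    ring
  simp [conjEval, this]

/-- Euler's identity for homogeneous polynomials, conjugated. -/
lemma sum_coord_mul_conjEval_pderiv {d k : ℕ} {P : MvPolynomial (Fin d) ℂ}
    (hP : P.IsHomogeneous k) (x : Euc d) :
    ∑ i, ((x i : ℝ) : ℂ) * conjEval (MvPolynomial.pderiv i P) x = k * conjEval P x := by
  have h := congrArg (fun Q => conjEval Q x) hP.sum_X_mul_pderiv
  simpa [conjEval, evalAt, nsmul_eq_mul] using h

lemma sum_conjEval_pderiv_pderiv {d : ℕ} {P : MvPolynomial (Fin d) ℂ}
    (hP : polyLaplacian d P = 0) (x : Euc d) :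
    ∑ i, conjEval (MvPolynomial.pderiv i (MvPolynomial.pderiv i P)) x = 0 := by
  have h := congrArg (fun Q => conjEval Q x) hP
  simpa [conjEval, evalAt, polyLaplacian] using h

/-! ### The Laplacian in coordinates -/

lemma laplacian_eq_sum_fderiv {d : ℕ} {f : Euc d → ℂ} {x : Euc d} (hf : ContDiffAt ℝ ∞ f x) :
    Laplacian.laplacian f x = ∑ i, fderiv ℝ
      (fun y => fderiv ℝ f y (EuclideanSpace.single i 1)) x (EuclideanSpace.single i 1) := by
  rw [InnerProductSpace.laplacian_eq_iteratedFDeriv_orthonormalBasis f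
    (EuclideanSpace.basisFun (Fin d) ℝ)]
  refine Finset.sum_congr rfl fun i _ => ?_
  have h : DifferentiableAt ℝ (fderiv ℝ f) x :=
    (hf.fderiv_right (m := 1) (by norm_cast)).differentiableAt (by simp)
  rw [iteratedFDeriv_two_apply, fderiv_clm_apply h (differentiableAt_const _)]
  simp

lemma contDiffOn_laplacian {d : ℕ} {f : Euc d → ℂ} {G : Set (Euc d)} (hG : IsOpen G)
    (hf : ContDiffOn ℝ ∞ f G) : ContDiffOn ℝ ∞ (Laplacian.laplacian f) G := by
  intro x hx
  have hx' : ContDiffAt ℝ ∞ f x := hf.contDiffAt (hG.mem_nhds hx)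
  have h : ContDiffAt ℝ ∞ (fun x => ∑ i : Fin d, fderiv ℝ
      (fun y => fderiv ℝ f y (EuclideanSpace.single i 1)) x (EuclideanSpace.single i 1)) x := by
    refine ContDiffAt.sum fun i _ => ?_
    have h1 : ContDiffAt ℝ ∞ (fun y => fderiv ℝ f y (EuclideanSpace.single i 1)) x :=
      (hx'.fderiv_right (m := ∞) (by norm_cast)).clm_apply contDiffAt_const
    exact (h1.fderiv_right (m := ∞) (by norm_cast)).clm_apply contDiffAt_const
  refine (h.congr_of_eventuallyEq ?_).contDiffWithinAt
  filter_upwards [hG.mem_nhds hx] with y hy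
  exact laplacian_eq_sum_fderiv (hf.contDiffAt (hG.mem_nhds hy))

lemma contDiffOn_laplacian_iterate {d : ℕ} {f : Euc d → ℂ} {G : Set (Euc d)} (hG : IsOpen G)
    (hf : ContDiffOn ℝ ∞ f G) (p : ℕ) :
    ContDiffOn ℝ ∞ ((fun g : Euc d → ℂ => Laplacian.laplacian g)^[p] f) G := by
  induction p with
  | zero => exact hf
  | succ p ih => rw [Function.iterate_succ_apply']; exact contDiffOn_laplacian hG ih

/-! ### Smoothness of spherical integrals -/

/-- Differentiation under the integral over the sphere. -/
lemma hasDerivAt_integral_sphere {d : ℕ} (μ : Measure (Metric.sphere (0 : Euc d) 1))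
    [IsFiniteMeasure μ] {g : ℝ × Euc d → ℂ} (hg : ContDiff ℝ ∞ g) (r : ℝ) :
    HasDerivAt (fun s => ∫ θ, g (s, (θ : Euc d)) ∂μ)
      (∫ θ, fderiv ℝ g (r, (θ : Euc d)) (1, 0) ∂μ) r := by
  have hc : Continuous fun q : ℝ × Euc d => fderiv ℝ g q (1, 0) :=
    (hg.continuous_fderiv (by simp)).clm_apply continuous_const
  have hK : IsCompact (Metric.closedBall r 1 ×ˢ Metric.sphere (0 : Euc d) 1) :=
    (isCompact_closedBall _ _).prod (isCompact_sphere _ _)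
  obtain ⟨C, hC⟩ := hK.exists_bound_of_continuousOn hc.continuousOn
  have hm (s : ℝ) {h : ℝ × Euc d → ℂ} (hh : Continuous h) :
      Continuous fun θ : Metric.sphere (0 : Euc d) 1 => h (s, (θ : Euc d)) := by fun_prop
  refine (hasDerivAt_integral_of_dominated_loc_of_deriv_le (bound := fun _ => C)
    (F := fun s (θ : Metric.sphere (0 : Euc d) 1) => g (s, (θ : Euc d)))
    (F' := fun s (θ : Metric.sphere (0 : Euc d) 1) => fderiv ℝ g (s, (θ : Euc d)) (1, 0))
    (Metric.closedBall_mem_nhds r one_pos) ?_ ?_ ?_ ?_ (integrable_const C) ?_).2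
  · exact Eventually.of_forall fun s => (hm s hg.continuous).aestronglyMeasurable
  · exact (hm r hg.continuous).integrable_of_hasCompactSupport (HasCompactSupport.of_compactSpace _)
  · exact (hm r hc).aestronglyMeasurable
  · exact ae_of_all _ fun θ s hs => hC _ ⟨hs, θ.2⟩
  · refine ae_of_all _ fun θ s _ => ?_
    have h1 : HasDerivAt (fun s : ℝ => (s, (θ : Euc d))) (1, 0) s :=
      (hasDerivAt_id s).prodMk (hasDerivAt_const _ _)
    exact ((hg.differentiable (by simp)) (s, (θ : Euc d))).hasFDerivAt.comp_hasDerivAt s h1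

/-- The derivative is a spherical integral of the same kind, with ∂g/∂s in place of g, so induction
on the order works once g is left general. -/
lemma contDiff_integral_sphere {d : ℕ} (μ : Measure (Metric.sphere (0 : Euc d) 1))
    [IsFiniteMeasure μ] {g : ℝ × Euc d → ℂ} (hg : ContDiff ℝ ∞ g) :
    ContDiff ℝ ∞ (fun s => ∫ θ, g (s, (θ : Euc d)) ∂μ) := by
  rw [contDiff_infty]
  intro n
  induction n generalizing g with
  | zero =>
    simp only [Nat.cast_zero, contDiff_zero, continuous_iff_continuousAt]
    exact fun r => (hasDerivAt_integral_sphere μ hg r).continuousAt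
  | succ n ih =>
    rw [Nat.cast_succ, contDiff_succ_iff_deriv]
    refine ⟨fun r => (hasDerivAt_integral_sphere μ hg r).differentiableAt, by simp, ?_⟩
    rw [funext fun r => (hasDerivAt_integral_sphere μ hg r).deriv]
    exact ih ((hg.fderiv_right (m := ∞) (by norm_cast)).clm_apply contDiff_const)

/-! ### Polar coordinates -/

/-- Integration in polar coordinates. -/
lemma integral_eq_integral_Ioi_sphere {d : ℕ} (hd : 1 ≤ d) {h : Euc d → ℂ}
    (hh : Integrable h) :
    ∫ x, h x = ∫ r in Ioi (0 : ℝ), ((r : ℂ) ^ (d - 1)) *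
      ∫ θ, h (r • (θ : Euc d)) ∂(sphereMeasure d) := by
  have hdim : Module.finrank ℝ (Euc d) = d := by simp
  have hnt : Nontrivial (Euc d) := Module.nontrivial_of_finrank_pos (R := ℝ) (by omega)
  have hmp := (volume : Measure (Euc d)).measurePreserving_homeomorphUnitSphereProd
  have hemb := (homeomorphUnitSphereProd (Euc d)).measurableEmbedding
  let H : Metric.sphere (0 : Euc d) 1 × Ioi (0 : ℝ) → ℂ := fun q => h (q.2.1 • (q.1 : Euc d))
  have hH (x : ({0}ᶜ : Set (Euc d))) : H (homeomorphUnitSphereProd (Euc d) x) = h x := by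
    have hx : ‖(x : Euc d)‖ ≠ 0 := norm_ne_zero_iff.2 x.2
    simp [H, smul_smul, hx]
  have hint : Integrable H ((volume : Measure (Euc d)).toSphere.prod
      (.volumeIoiPow (Module.finrank ℝ (Euc d) - 1))) := by
    rw [← hmp.integrable_comp_emb hemb]
    have : H ∘ homeomorphUnitSphereProd (Euc d) = h ∘ Subtype.val := funext hH
    rw [this, ← integrableOn_iff_comap_subtypeVal (measurableSet_singleton _).compl]
    exact hh.integrableOn
  -- Discard the origin, a null set; transport to sphere × (0, ∞); apply Fubini; unfold the density
  -- r^(d-1) of the radial measure.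
  calc ∫ x, h x = ∫ x : ({0}ᶜ : Set (Euc d)), h x ∂((volume : Measure (Euc d)).comap (↑)) := by
        rw [integral_subtype_comap (measurableSet_singleton _).compl h, restrict_compl_singleton]
    _ = ∫ q, H q ∂((volume : Measure (Euc d)).toSphere.prod
          (.volumeIoiPow (Module.finrank ℝ (Euc d) - 1))) := by
        rw [← hmp.integral_comp hemb]
        exact integral_congr_ae (ae_of_all _ fun x => (hH x).symm)
    _ = ∫ r : Ioi (0 : ℝ), (∫ θ, h (r.1 • (θ : Euc d)) ∂(sphereMeasure d))
          ∂(.volumeIoiPow (Module.finrank ℝ (Euc d) - 1)) := integral_prod_symm _ hint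
    _ = _ := by
        simp only [Measure.volumeIoiPow, ENNReal.ofReal]
        rw [integral_withDensity_eq_integral_smul, hdim,
          integral_subtype_comap measurableSet_Ioi fun a : ℝ ↦ Real.toNNReal (a ^ (d - 1)) •
            ∫ θ, h (a • (θ : Euc d)) ∂(sphereMeasure d),
          setIntegral_congr_fun measurableSet_Ioi fun x hx ↦ ?_]
        · rw [NNReal.smul_def, Real.coe_toNNReal _ (pow_nonneg hx.out.le _)]
          simp
        · exact (measurable_subtype_coe.pow_const _).real_toNNReal

/-! ### Radial test functions -/

lemma eventually_comp_norm_eq_zero {d : ℕ} {F : Type*} [Zero F] {ψ : ℝ → F} {x : Euc d}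
    (hx : ‖x‖ ∉ tsupport ψ) : ∀ᶠ y : Euc d in 𝓝 x, ψ ‖y‖ = 0 :=
  continuous_norm.continuousAt.eventually (notMem_tsupport_iff_eventuallyEq.1 hx)

/-- The norm is smooth away from 0; near 0, and wherever |x| leaves the support, the function is
locally zero. -/
lemma contDiff_comp_norm {d : ℕ} {ψ : ℝ → ℝ} (hψ : ContDiff ℝ ∞ ψ)
    (hs : tsupport ψ ⊆ Ioi 0) : ContDiff ℝ ∞ fun x : Euc d => ((ψ ‖x‖ : ℝ) : ℂ) := by
  rw [contDiff_iff_contDiffAt]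
  intro x
  by_cases hx : ‖x‖ ∈ tsupport ψ
  · have hx0 : x ≠ 0 := norm_pos_iff.1 (hs hx)
    exact Complex.ofRealCLM.contDiff.contDiffAt.comp x
      (hψ.contDiffAt.comp x (contDiffAt_norm ℝ hx0))
  · refine (contDiffAt_const (c := (0 : ℂ))).congr_of_eventuallyEq ?_
    filter_upwards [eventually_comp_norm_eq_zero hx] with y hy
    simp [hy]

lemma hasCompactSupport_comp_norm {d : ℕ} {ψ : ℝ → ℝ} (hc : HasCompactSupport ψ) :
    HasCompactSupport fun x : Euc d => ((ψ ‖x‖ : ℝ) : ℂ) := by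
  obtain ⟨R, hR⟩ := hc.isCompact.isBounded.subset_closedBall 0
  refine HasCompactSupport.intro (isCompact_closedBall (0 : Euc d) R) fun x hx => ?_
  have : ‖x‖ ∉ tsupport ψ := fun h => hx (by simpa using hR h)
  simp [image_eq_zero_of_notMem_tsupport this]

lemma fderiv_comp_norm_single {d : ℕ} {ψ : ℝ → ℝ} (hψ : ContDiff ℝ ∞ ψ)
    (hs : tsupport ψ ⊆ Ioi 0) (x : Euc d) (i : Fin d) :
    fderiv ℝ (fun x : Euc d => ((ψ ‖x‖ : ℝ) : ℂ)) x (EuclideanSpace.single i 1) =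
      ((deriv ψ ‖x‖ / ‖x‖ : ℝ) : ℂ) * ((x i : ℝ) : ℂ) := by
  by_cases hx : ‖x‖ ∈ tsupport ψ
  · have hx0 : x ≠ 0 := norm_pos_iff.1 (hs hx)
    have hn : HasFDerivAt (fun y : Euc d => ‖y‖) (‖x‖⁻¹ • innerSL ℝ x) x := by
      have h := (hasStrictFDerivAt_norm_sq x).hasFDerivAt.sqrt (by simpa using hx0)
      simp only [Real.sqrt_sq (norm_nonneg _)] at h
      convert! h using 1
      ext v
      simp
      field_simp
    have h2 : HasDerivAt ψ (deriv ψ ‖x‖) ‖x‖ :=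
      (hψ.differentiable (by simp) _).hasDerivAt
    have h3 := Complex.ofRealCLM.hasFDerivAt.comp x (h2.comp_hasFDerivAt x hn)
    have h4 : fderiv ℝ (fun x : Euc d => ((ψ ‖x‖ : ℝ) : ℂ)) x = _ := h3.fderiv
    rw [h4]
    simp [EuclideanSpace.inner_single_right]
    ring
  · have h1 : (fun x : Euc d => ((ψ ‖x‖ : ℝ) : ℂ)) =ᶠ[𝓝 x] fun _ => 0 := by
      filter_upwards [eventually_comp_norm_eq_zero hx] with y hy
      simp [hy]
    have h2 : deriv ψ ‖x‖ = 0 :=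
      image_eq_zero_of_notMem_tsupport fun h => hx (closure_minimal (support_deriv_subset)
        (isClosed_tsupport ψ) h)
    rw [h1.fderiv_eq, h2]
    simp

/-! ### Divergence theorem and the weak equation on ℝ^d -/

lemma integral_fderiv_eq_zero_of_hasCompactSupport {d : ℕ} {g : Euc d → ℂ}
    (hg : ContDiff ℝ ∞ g) (hc : HasCompactSupport g) (v : Euc d) :
    ∫ x, fderiv ℝ g x v = 0 := by
  have hg' : Continuous fun x => fderiv ℝ g x v :=
    (hg.continuous_fderiv (by simp)).clm_apply continuous_const
  -- Integration by parts against the constant 1.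
  have h := integral_mul_fderiv_eq_neg_fderiv_mul_of_integrable (μ := (volume : Measure (Euc d)))
    (f := fun _ => (1 : ℂ)) (g := g) (v := v) (by simp)
    (by simpa using hg'.integrable_of_hasCompactSupport (hc.fderiv_apply (𝕜 := ℝ) v))
    (by simpa using hg.continuous.integrable_of_hasCompactSupport hc)
    (fun _ _ => differentiableAt_const _) (fun x _ => hg.differentiable (by simp) x)
  simpa using h

lemma sum_coord_mul_fderiv_single {d : ℕ} (f : Euc d → ℂ) (x : Euc d) :
    ∑ i, ((x i : ℝ) : ℂ) * fderiv ℝ f x (EuclideanSpace.single i 1) = fderiv ℝ f x x := by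
  have h := congrArg (fderiv ℝ f x) ((EuclideanSpace.basisFun (Fin d) ℝ).sum_repr x)
  rw [map_sum] at h
  simpa using h

/-- The weak form of the radial equation: testing `Δf` against a radial function times a
harmonic homogeneous polynomial. -/
lemma integral_laplacian_mul_radial {d k : ℕ} {f : Euc d → ℂ} (hf : ContDiff ℝ ∞ f)
    {P : MvPolynomial (Fin d) ℂ} (hP : P ∈ harmonicPoly d k)
    {ψ : ℝ → ℝ} (hψ : ContDiff ℝ ∞ ψ) (hc : HasCompactSupport ψ) (hs : tsupport ψ ⊆ Ioi 0) :
    Integrable (fun x => (Laplacian.laplacian f x * (ψ ‖x‖ : ℝ)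
      + ((deriv ψ ‖x‖ / ‖x‖ : ℝ) : ℂ) * (fderiv ℝ f x x - k * f x)) * conjEval P x) ∧
    ∫ x, (Laplacian.laplacian f x * (ψ ‖x‖ : ℝ)
      + ((deriv ψ ‖x‖ / ‖x‖ : ℝ) : ℂ) * (fderiv ℝ f x x - k * f x)) * conjEval P x = 0 := by
  have hhom : P.IsHomogeneous k := (MvPolynomial.mem_homogeneousSubmodule _ _).1 hP.1
  have hlap : polyLaplacian d P = 0 := LinearMap.mem_ker.1 hP.2
  set u : Euc d → ℂ := fun x => ((ψ ‖x‖ : ℝ) : ℂ) with hu_def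
  have hu : ContDiff ℝ ∞ u := contDiff_comp_norm hψ hs
  have huc : HasCompactSupport u := hasCompactSupport_comp_norm hc
  let e (i : Fin d) : Euc d := EuclideanSpace.single i 1
  let f' (i : Fin d) : Euc d → ℂ := fun x => fderiv ℝ f x (e i)
  have hf' (i) : ContDiff ℝ ∞ (f' i) :=
    (hf.fderiv_right (m := ∞) (by norm_cast)).clm_apply contDiff_const
  let Q := conjEval P
  let Q' (i : Fin d) : Euc d → ℂ := conjEval (MvPolynomial.pderiv i P)
  have hQ : ContDiff ℝ ∞ Q := contDiff_conjEval P
  have hQ' (i) : ContDiff ℝ ∞ (Q' i) := contDiff_conjEval _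
  -- Components of the field u(Q∇f - f∇Q). In its divergence the cross terms ∇f·∇Q cancel, leaving
  -- ∇u·(Q∇f - f∇Q) + u(QΔf - fΔQ).
  let g (i : Fin d) : Euc d → ℂ := fun x => u x * (f' i x * Q x - f x * Q' i x)
  have hg (i) : ContDiff ℝ ∞ (g i) := hu.mul (((hf' i).mul hQ).sub (hf.mul (hQ' i)))
  have hgc (i) : HasCompactSupport (g i) := huc.mul_right
  have hdiff {h : Euc d → ℂ} (hh : ContDiff ℝ ∞ h) (x) : DifferentiableAt ℝ h x :=
    hh.differentiable (by simp) x
  have hg' (i x) : fderiv ℝ (g i) x (e i) =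
      ((deriv ψ ‖x‖ / ‖x‖ : ℝ) : ℂ) * ((x i : ℝ) : ℂ) * (f' i x * Q x - f x * Q' i x)
      + u x * (fderiv ℝ (f' i) x (e i) * Q x
        - f x * conjEval (MvPolynomial.pderiv i (MvPolynomial.pderiv i P)) x) := by
    rw [fderiv_fun_mul (hdiff hu x) (hdiff (((hf' i).mul hQ).sub (hf.mul (hQ' i))) x),
      fderiv_fun_sub (hdiff ((hf' i).mul hQ) x) (hdiff (hf.mul (hQ' i)) x),
      fderiv_fun_mul (hdiff (hf' i) x) (hdiff hQ x), fderiv_fun_mul (hdiff hf x) (hdiff (hQ' i) x)]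
    simp only [add_apply, sub_apply, smul_apply, smul_eq_mul]
    rw [fderiv_comp_norm_single hψ hs x i, fderiv_conjEval_single, fderiv_conjEval_single]
    simp only [f', Q', Q, e]
    ring
  have hsum (x) : ∑ i, fderiv ℝ (g i) x (e i) = (Laplacian.laplacian f x * u x
      + ((deriv ψ ‖x‖ / ‖x‖ : ℝ) : ℂ) * (fderiv ℝ f x x - k * f x)) * conjEval P x := by
    have h1 := sum_coord_mul_conjEval_pderiv hhom x
    have h2 := sum_conjEval_pderiv_pderiv hlap x
    have h3 := sum_coord_mul_fderiv_single f x
    have h4 := laplacian_eq_sum_fderiv (x := x) hf.contDiffAt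
    set w : ℂ := ((deriv ψ ‖x‖ / ‖x‖ : ℝ) : ℂ)
    calc ∑ i, fderiv ℝ (g i) x (e i)
        = ∑ i, (w * Q x * (((x i : ℝ) : ℂ) * f' i x) - w * f x * (((x i : ℝ) : ℂ) * Q' i x)
          + u x * Q x * fderiv ℝ (f' i) x (e i)
          - u x * f x * conjEval (MvPolynomial.pderiv i (MvPolynomial.pderiv i P)) x) := by
          refine Finset.sum_congr rfl fun i _ => ?_
          rw [hg' i x]; ring
      _ = w * Q x * fderiv ℝ f x x - w * f x * (k * Q x) + u x * Q x * Laplacian.laplacian f x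
          - u x * f x * 0 := by
          rw [Finset.sum_sub_distrib, Finset.sum_add_distrib, Finset.sum_sub_distrib,
            ← Finset.mul_sum, ← Finset.mul_sum, ← Finset.mul_sum, ← Finset.mul_sum]
          rw [h2, h3, h4, h1]
      _ = _ := by simp only [Q]; ring
  have hint (i) : Integrable fun x => fderiv ℝ (g i) x (e i) :=
    (((hg i).continuous_fderiv (by simp)).clm_apply
      continuous_const).integrable_of_hasCompactSupport ((hgc i).fderiv_apply (𝕜 := ℝ) (e i))
  refine ⟨(integrable_finsetSum _ fun i _ => hint i).congr (ae_of_all _ hsum),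
    (integral_congr_ae (ae_of_all _ hsum)).symm.trans ?_⟩
  rw [integral_finsetSum _ fun i _ => hint i]
  exact Finset.sum_eq_zero fun i _ =>
    integral_fderiv_eq_zero_of_hasCompactSupport (hg i) (hgc i) (e i)

/-! ### Coefficients of functions smooth on ℝ^d and their radial equation -/

instance (d : ℕ) : IsFiniteMeasure (sphereMeasure d) :=
  inferInstanceAs (IsFiniteMeasure (volume : Measure (Euc d)).toSphere)

lemma integrable_sphere {d : ℕ} {h : Euc d → ℂ} (hh : Continuous h) :
    Integrable (fun θ : Metric.sphere (0 : Euc d) 1 => h θ) (sphereMeasure d) :=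
  (hh.comp continuous_subtype_val).integrable_of_hasCompactSupport
    (HasCompactSupport.of_compactSpace _)

lemma contDiff_smul_mul_conjEval {d : ℕ} {f : Euc d → ℂ} (hf : ContDiff ℝ ∞ f)
    (P : MvPolynomial (Fin d) ℂ) :
    ContDiff ℝ ∞ fun q : ℝ × Euc d => f (q.1 • q.2) * conjEval P q.2 :=
  (hf.comp (contDiff_fst.smul contDiff_snd)).mul ((contDiff_conjEval P).comp contDiff_snd)

lemma contDiff_flCoeff {d : ℕ} {f : Euc d → ℂ} (hf : ContDiff ℝ ∞ f)
    (P : MvPolynomial (Fin d) ℂ) : ContDiff ℝ ∞ (flCoeff f P) :=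
  contDiff_integral_sphere (sphereMeasure d) (contDiff_smul_mul_conjEval hf P)

lemma deriv_flCoeff {d : ℕ} {f : Euc d → ℂ} (hf : ContDiff ℝ ∞ f)
    (P : MvPolynomial (Fin d) ℂ) (r : ℝ) :
    deriv (flCoeff f P) r =
      ∫ θ, fderiv ℝ f (r • (θ : Euc d)) (θ : Euc d) * conjEval P θ ∂(sphereMeasure d) := by
  have hg := contDiff_smul_mul_conjEval hf P
  refine (hasDerivAt_integral_sphere (sphereMeasure d) hg r).deriv.trans ?_
  refine integral_congr_ae (ae_of_all _ fun θ => ?_)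
  have h1 : HasDerivAt (fun s : ℝ => (s, (θ : Euc d))) (1, 0) r :=
    (hasDerivAt_id r).prodMk (hasDerivAt_const _ _)
  have h2 := ((hg.differentiable (by simp)) (r, (θ : Euc d))).hasFDerivAt.comp_hasDerivAt r h1
  have h3 : HasDerivAt (fun s : ℝ => s • (θ : Euc d)) (θ : Euc d) r := by
    simpa using (hasDerivAt_id r).smul_const (θ : Euc d)
  have h4 := ((hf.differentiable (by simp) _).hasFDerivAt.comp_hasDerivAt r h3).mul_const
    (conjEval P θ)
  exact h2.unique h4

/-- The weak radial equation in polar coordinates. -/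
lemma integral_radial_eq_zero {d k : ℕ} (hd : 2 ≤ d) {f : Euc d → ℂ} (hf : ContDiff ℝ ∞ f)
    {P : MvPolynomial (Fin d) ℂ} (hP : P ∈ harmonicPoly d k)
    {ψ : ℝ → ℝ} (hψ : ContDiff ℝ ∞ ψ) (hc : HasCompactSupport ψ) (hs : tsupport ψ ⊆ Ioi 0) :
    ∫ r : ℝ, ((ψ r : ℂ) * ((r : ℂ) ^ (d - 2 + k + 1) * flCoeff (Laplacian.laplacian f) P r)
      + ((deriv ψ r : ℝ) : ℂ) * ((r : ℂ) ^ (d - 2 + k + 1) * deriv (flCoeff f P) r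
        - k * (r : ℂ) ^ (d - 2 + k) * flCoeff f P r)) = 0 := by
  have hhom : P.IsHomogeneous k := (MvPolynomial.mem_homogeneousSubmodule _ _).1 hP.1
  obtain ⟨hint, hzero⟩ := integral_laplacian_mul_radial hf hP hψ hc hs
  rw [integral_eq_integral_Ioi_sphere (by omega) hint] at hzero
  have hsupp (r : ℝ) (hr : r ∉ Ioi (0 : ℝ)) : ψ r = 0 ∧ deriv ψ r = 0 := by
    have h : r ∉ tsupport ψ := fun h => hr (hs h)
    exact ⟨image_eq_zero_of_notMem_tsupport h, image_eq_zero_of_notMem_tsupport fun h' =>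
      h (closure_minimal support_deriv_subset (isClosed_tsupport ψ) h')⟩
  -- ψ and ψ' vanish off (0, ∞), so the integral over ℝ is the polar one.
  rw [← setIntegral_eq_integral_of_forall_compl_eq_zero (s := Ioi (0 : ℝ)), ← hzero]
  swap
  · intro r hr
    simp [hsupp r hr]
  refine setIntegral_congr_fun measurableSet_Ioi fun r hr => ?_
  have hr0 : (0 : ℝ) < r := hr
  have hrc : (r : ℂ) ≠ 0 := by exact_mod_cast hr0.ne'
  have hLc : Continuous (Laplacian.laplacian f) := by
    have := contDiffOn_laplacian isOpen_univ (contDiffOn_univ.2 hf)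
    exact (contDiffOn_univ.1 this).continuous
  have hfc' : Continuous fun x : Euc d => fderiv ℝ f (r • x) x :=
    ((hf.continuous_fderiv (by simp)).comp (continuous_const_smul r)).clm_apply continuous_id
  have hQ := (contDiff_conjEval P).continuous
  have i1 := integrable_sphere (d := d) ((hLc.comp (continuous_const_smul r)).mul hQ)
  have i2 := integrable_sphere (d := d) (hfc'.mul hQ)
  have i3 := integrable_sphere (d := d) ((hf.continuous.comp (continuous_const_smul r)).mul hQ)
  have hpt (θ : Metric.sphere (0 : Euc d) 1) :
      (Laplacian.laplacian f (r • (θ : Euc d)) * (ψ ‖r • (θ : Euc d)‖ : ℝ)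
      + ((deriv ψ ‖r • (θ : Euc d)‖ / ‖r • (θ : Euc d)‖ : ℝ) : ℂ)
        * (fderiv ℝ f (r • (θ : Euc d)) (r • (θ : Euc d)) - k * f (r • (θ : Euc d))))
        * conjEval P (r • (θ : Euc d))
      = (ψ r * (r : ℂ) ^ k) * (Laplacian.laplacian f (r • (θ : Euc d)) * conjEval P θ)
        + (((deriv ψ r : ℝ) : ℂ) * (r : ℂ) ^ k) *
          (fderiv ℝ f (r • (θ : Euc d)) (θ : Euc d) * conjEval P θ)
        - (((deriv ψ r : ℝ) : ℂ) / r * k * (r : ℂ) ^ k) * (f (r • (θ : Euc d)) * conjEval P θ) := by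
    have hn : ‖r • (θ : Euc d)‖ = r := by simp [norm_smul, hr0.le]
    rw [hn, conjEval_smul hhom, map_smul, Complex.real_smul]
    push_cast
    field_simp
    ring
  simp only [hpt]
  rw [integral_sub, integral_add, integral_const_mul, integral_const_mul, integral_const_mul,
    ← deriv_flCoeff hf]
  · change _ = _ * (_ * flCoeff (Laplacian.laplacian f) P r + _ - _ * flCoeff f P r)
    -- Removes the truncated subtractions in d - 1 and d - 2. The power r^(d-1) comes from the polar
    -- density, r^k from the homogeneity of P.
    obtain ⟨n, rfl⟩ : ∃ n, d = n + 2 := ⟨d - 2, by omega⟩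
    simp only [Nat.add_sub_cancel, show n + 2 - 1 = n + 1 by omega, pow_add, pow_one]
    field_simp
    ring
  · exact i1.const_mul _
  · exact i2.const_mul _
  · exact (i1.const_mul _).add (i2.const_mul _)
  · exact i3.const_mul _

/-- The radial operator intertwines with the Laplacian under Fourier–Laplace coefficients. -/
lemma radialOp_flCoeff_of_contDiff {d k : ℕ} (hd : 2 ≤ d) {f : Euc d → ℂ} (hf : ContDiff ℝ ∞ f)
    {P : MvPolynomial (Fin d) ℂ} (hP : P ∈ harmonicPoly d k) {r : ℝ} (hr : 0 < r) :
    radialOp d k (flCoeff f P) r = flCoeff (Laplacian.laplacian f) P r := by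
  set m := d - 2 + k with hm
  set F := flCoeff f P
  set G := flCoeff (Laplacian.laplacian f) P
  have hF : ContDiff ℝ ∞ F := contDiff_flCoeff hf P
  have hF' : ContDiff ℝ ∞ (deriv F) := (contDiff_infty_iff_deriv.1 hF).2
  have hG : ContDiff ℝ ∞ G := contDiff_flCoeff
    (contDiffOn_univ.1 (contDiffOn_laplacian isOpen_univ (contDiffOn_univ.2 hf))) P
  have hX (n : ℕ) : ContDiff ℝ ∞ fun r : ℝ => (r : ℂ) ^ n := Complex.ofRealCLM.contDiff.pow n
  -- The flux whose derivative is r^(m+1) L_k F: here m + 1 - k = d - 1 and km = k(k + d - 2).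
  let H : ℝ → ℂ := fun r => (r : ℂ) ^ (m + 1) * deriv F r - k * (r : ℂ) ^ m * F r
  have hH : ContDiff ℝ ∞ H := ((hX _).mul hF').sub ((contDiff_const.mul (hX m)).mul hF)
  have hH' : ContDiff ℝ ∞ (deriv H) := (contDiff_infty_iff_deriv.1 hH).2
  let J : ℝ → ℂ := fun r => (r : ℂ) ^ (m + 1) * G r - deriv H r
  have hJ : Continuous J := ((hX _).mul hG).continuous.sub hH'.continuous
  have hweak : ∀ ψ : ℝ → ℝ, ContDiff ℝ ∞ ψ → HasCompactSupport ψ → tsupport ψ ⊆ Ioi 0 →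
      ∫ x, ψ x • J x = 0 := by
    intro ψ hψ hc hs
    have hz := integral_radial_eq_zero hd hf hP hψ hc hs
    have hψc : Continuous fun r => (ψ r : ℂ) := Complex.continuous_ofReal.comp hψ.continuous
    have hψc' : Continuous fun r => ((deriv ψ r : ℝ) : ℂ) :=
      Complex.continuous_ofReal.comp (hψ.continuous_deriv (by simp))
    have hcc : HasCompactSupport fun r => (ψ r : ℂ) := hc.comp_left Complex.ofReal_zero
    have hcc' : HasCompactSupport fun r => ((deriv ψ r : ℝ) : ℂ) := hc.deriv.comp_left Complex.ofReal_zero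
    have i1 : Integrable fun r : ℝ => (ψ r : ℂ) * ((r : ℂ) ^ (m + 1) * G r) :=
      (hψc.mul ((hX _).mul hG).continuous).integrable_of_hasCompactSupport hcc.mul_right
    have i2 : Integrable fun r : ℝ => ((deriv ψ r : ℝ) : ℂ) * H r :=
      (hψc'.mul hH.continuous).integrable_of_hasCompactSupport hcc'.mul_right
    have i3 : Integrable fun r : ℝ => (ψ r : ℂ) * deriv H r :=
      (hψc.mul hH'.continuous).integrable_of_hasCompactSupport hcc.mul_right
    have i4 : Integrable fun r : ℝ => (ψ r : ℂ) * H r :=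
      (hψc.mul hH.continuous).integrable_of_hasCompactSupport hcc.mul_right
    have hparts : ∫ r : ℝ, (ψ r : ℂ) * deriv H r = -∫ r : ℝ, ((deriv ψ r : ℝ) : ℂ) * H r :=
      integral_mul_deriv_eq_deriv_mul_of_integrable
        (fun r _ => (hψ.differentiable (by simp) r).hasDerivAt.ofReal_comp)
        (fun r _ => (hH.differentiable (by simp) r).hasDerivAt) i3 i2 i4
    rw [integral_add i1 i2] at hz
    simp only [J, Complex.real_smul, mul_sub]
    rw [integral_sub i1 i3, hparts, sub_neg_eq_add]
    exact hz
  -- Fundamental lemma of the calculus of variations; continuity of J then upgrades "almost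
  -- everywhere" to every r > 0.
  have hae := isOpen_Ioi.ae_eq_zero_of_integral_contDiff_smul_eq_zero (μ := volume)
    (hJ.locallyIntegrable.locallyIntegrableOn (Ioi 0)) hweak
  have hJr : J r = 0 := by
    have h0 : J =ᵐ[volume.restrict (Ioi 0)] fun _ => 0 :=
      (ae_restrict_iff' measurableSet_Ioi).2 hae
    exact Measure.eqOn_open_of_ae_eq h0 isOpen_Ioi hJ.continuousOn continuousOn_const hr
  have hrc : (r : ℂ) ≠ 0 := by exact_mod_cast hr.ne'
  have hpow (n : ℕ) : HasDerivAt (fun s : ℝ => (s : ℂ) ^ n) (n * (r : ℂ) ^ (n - 1)) r := by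
    simpa using ((hasDerivAt_id r).ofReal_comp).fun_pow n
  have hHr : HasDerivAt H _ r := ((hpow (m + 1)).mul
    (hF'.differentiable (by simp) r).hasDerivAt).sub
      (((hpow m).const_mul (k : ℂ)).mul (hF.differentiable (by simp) r).hasDerivAt)
  -- The exponent m - 1 truncates when m = 0 (d = 2, k = 0), but the factor m vanishes there.
  have hpm : (m : ℂ) * (r : ℂ) ^ (m - 1) = m * (r : ℂ) ^ m / r := by
    rcases Nat.eq_zero_or_pos m with h | h
    · simp [h]
    · obtain ⟨n, hn⟩ : ∃ n, m = n + 1 := ⟨m - 1, by omega⟩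
      rw [hn, Nat.add_sub_cancel, pow_succ]; field_simp
  have hmc : (m : ℂ) = d - 2 + k := by
    rw [hm]; push_cast [Nat.cast_sub hd]; ring
  simp only [J, hHr.deriv] at hJr
  rw [hpm] at hJr
  have hG' : (r : ℂ) ^ m * (r * G r) = (r : ℂ) ^ m * (r * radialOp d k F r) := by
    rw [← sub_eq_zero, ← hJr, radialOp]
    push_cast
    rw [hmc, pow_succ]
    field_simp
    ring
  have := mul_left_cancel₀ (pow_ne_zero m hrc) hG'
  exact (mul_left_cancel₀ hrc this).symm

/-! ### Localisation to the annulus and iteration -/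

lemma isOpen_radii (r₀ : ℝ) (r₁ : EReal) : IsOpen (radii r₀ r₁) :=
  (isOpen_lt continuous_const continuous_id).inter
    (isOpen_lt continuous_coe_real_ereal continuous_const)

lemma isOpen_annulus (d : ℕ) (r₀ : ℝ) (r₁ : EReal) : IsOpen (annulus d r₀ r₁) :=
  (isOpen_radii r₀ r₁).preimage continuous_norm

/-- A smooth function on the annulus agrees, near a given sphere, with one smooth on `ℝ^d`. -/
lemma exists_contDiff_eqOn_near_sphere {d : ℕ} {r₀ : ℝ} {r₁ : EReal} (hr₀ : 0 ≤ r₀)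
    {f : Euc d → ℂ} (hf : ContDiffOn ℝ ∞ f (annulus d r₀ r₁)) {r : ℝ} (hr : r ∈ radii r₀ r₁) :
    ∃ g : Euc d → ℂ, ContDiff ℝ ∞ g ∧ ∀ᶠ s in 𝓝 r, ∀ x : Euc d, ‖x‖ = s → f x = g x := by
  obtain ⟨δ, hδ, hsub⟩ := Metric.isOpen_iff.1 (isOpen_radii r₀ r₁) r hr
  -- χ is 1 on the closed δ/4-ball around r, and its support, the closed δ/2-ball, stays inside the
  -- δ-ball of admissible radii.
  let χ : ContDiffBump r := ⟨δ / 4, δ / 2, by positivity, by linarith⟩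
  have hts : tsupport χ ⊆ radii r₀ r₁ := by
    rw [χ.tsupport_eq]
    exact (Metric.closedBall_subset_ball (by change δ / 2 < δ; linarith)).trans hsub
  have hpos : tsupport χ ⊆ Ioi 0 := fun s hs => hr₀.trans_lt (hts hs).1
  refine ⟨fun x => ((χ ‖x‖ : ℝ) : ℂ) * f x, ?_, ?_⟩
  · rw [contDiff_iff_contDiffAt]
    intro x
    by_cases hx : ‖x‖ ∈ tsupport χ
    · exact (contDiff_comp_norm χ.contDiff hpos).contDiffAt.mul
        (hf.contDiffAt ((isOpen_annulus d r₀ r₁).mem_nhds (hts hx)))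
    · refine (contDiffAt_const (c := (0 : ℂ))).congr_of_eventuallyEq ?_
      filter_upwards [eventually_comp_norm_eq_zero hx] with y hy
      simp [hy]
  · filter_upwards [Metric.closedBall_mem_nhds r χ.rIn_pos] with s hs x hx
    simp [hx, χ.one_of_mem_closedBall hs]

lemma flCoeff_congr {d : ℕ} {f g : Euc d → ℂ} {r : ℝ} (hr : 0 ≤ r)
    (h : ∀ x : Euc d, ‖x‖ = r → f x = g x) (P : MvPolynomial (Fin d) ℂ) :
    flCoeff f P r = flCoeff g P r := by
  unfold flCoeff
  congr 1
  ext θ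
  rw [h (r • (θ : Euc d)) (by simp [norm_smul, hr])]

lemma radialOp_congr {d k : ℕ} {F G : ℝ → ℂ} {r : ℝ} (h : F =ᶠ[𝓝 r] G) :
    radialOp d k F r = radialOp d k G r := by
  unfold radialOp
  rw [h.deriv.deriv_eq, h.deriv_eq, h.eq_of_nhds]

lemma flCoeff_eventuallyEq {d : ℕ} {f g : Euc d → ℂ} {r : ℝ} (hr : 0 < r)
    (h : ∀ᶠ s in 𝓝 r, ∀ x : Euc d, ‖x‖ = s → f x = g x) (P : MvPolynomial (Fin d) ℂ) :
    flCoeff f P =ᶠ[𝓝 r] flCoeff g P := by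
  filter_upwards [h, lt_mem_nhds hr] with s hs hs0
  exact flCoeff_congr hs0.le hs P

lemma contDiffOn_flCoeff {d : ℕ} {r₀ : ℝ} {r₁ : EReal} (hr₀ : 0 ≤ r₀)
    {f : Euc d → ℂ} (hf : ContDiffOn ℝ ∞ f (annulus d r₀ r₁)) (P : MvPolynomial (Fin d) ℂ) :
    ContDiffOn ℝ ∞ (flCoeff f P) (radii r₀ r₁) := by
  intro r hr
  obtain ⟨g, hg, hfg⟩ := exists_contDiff_eqOn_near_sphere hr₀ hf hr
  exact ((contDiff_flCoeff hg P).contDiffAt.congr_of_eventuallyEq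
    (flCoeff_eventuallyEq (hr₀.trans_lt hr.1) hfg P)).contDiffWithinAt

lemma radialOp_flCoeff {d k : ℕ} (hd : 2 ≤ d) {r₀ : ℝ} {r₁ : EReal} (hr₀ : 0 ≤ r₀)
    {f : Euc d → ℂ} (hf : ContDiffOn ℝ ∞ f (annulus d r₀ r₁))
    {P : MvPolynomial (Fin d) ℂ} (hP : P ∈ harmonicPoly d k) {r : ℝ} (hr : r ∈ radii r₀ r₁) :
    radialOp d k (flCoeff f P) r = flCoeff (Laplacian.laplacian f) P r := by
  have hr0 : 0 < r := hr₀.trans_lt hr.1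
  obtain ⟨g, hg, hfg⟩ := exists_contDiff_eqOn_near_sphere hr₀ hf hr
  rw [radialOp_congr (flCoeff_eventuallyEq hr0 hfg P), radialOp_flCoeff_of_contDiff hd hg hP hr0]
  refine (flCoeff_congr hr0.le (fun x hx => ?_) P).symm
  -- Equality on the single sphere |x| = r would not determine Δf; equality on all nearby spheres
  -- gives it on a neighbourhood of x.
  have hfg' : f =ᶠ[𝓝 x] g := by
    have : ∀ᶠ y in 𝓝 x, ∀ z : Euc d, ‖z‖ = ‖y‖ → f z = g z :=
      continuous_norm.continuousAt.eventually (hx ▸ hfg)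
    filter_upwards [this] with y hy using hy y rfl
  exact (InnerProductSpace.laplacian_congr_nhds hfg').eq_of_nhds

/-- The equality holds only on the interval of radii; since that set is open, it can still be
differentiated at each induction step. -/
lemma radialOp_iterate_flCoeff {d k : ℕ} (hd : 2 ≤ d) {r₀ : ℝ} {r₁ : EReal} (hr₀ : 0 ≤ r₀)
    {f : Euc d → ℂ} (hf : ContDiffOn ℝ ∞ f (annulus d r₀ r₁))
    {P : MvPolynomial (Fin d) ℂ} (hP : P ∈ harmonicPoly d k) (p : ℕ) :
    ∀ r ∈ radii r₀ r₁, ((radialOp d k)^[p] (flCoeff f P)) r =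
      flCoeff ((fun g : Euc d → ℂ => Laplacian.laplacian g)^[p] f) P r := by
  induction p with
  | zero => exact fun _ _ => rfl
  | succ p ih =>
    intro r hr
    rw [Function.iterate_succ_apply', Function.iterate_succ_apply',
      ← radialOp_flCoeff hd hr₀ (contDiffOn_laplacian_iterate (isOpen_annulus d r₀ r₁) hf p) hP hr]
    refine radialOp_congr ?_
    filter_upwards [(isOpen_radii r₀ r₁).mem_nhds hr] with s hs using ih s hs

/-! ### The norm estimate -/

lemma integral_norm_conjEval_le {d : ℕ} {P : MvPolynomial (Fin d) ℂ}
    (hP : ∫ θ, evalAt P (θ : Euc d) * (starRingEnd ℂ) (evalAt P (θ : Euc d))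
      ∂(sphereMeasure d) = 1) :
    ∫ θ, ‖conjEval P (θ : Euc d)‖ ∂(sphereMeasure d) ≤ √(sphereArea d) := by
  have hQ : Continuous fun θ : Metric.sphere (0 : Euc d) 1 => ‖conjEval P θ‖ :=
    ((contDiff_conjEval P).continuous.comp continuous_subtype_val).norm
  have h2 : ∫ θ, ‖conjEval P (θ : Euc d)‖ ^ 2 ∂(sphereMeasure d) = 1 := by
    have : ∀ θ : Metric.sphere (0 : Euc d) 1,
        evalAt P (θ : Euc d) * (starRingEnd ℂ) (evalAt P (θ : Euc d)) =
          ((‖conjEval P (θ : Euc d)‖ ^ 2 : ℝ) : ℂ) := fun θ => by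
      rw [Complex.mul_conj, Complex.normSq_eq_norm_sq, conjEval, Complex.norm_conj]
    simp only [this] at hP
    rw [integral_complex_ofReal] at hP
    exact_mod_cast hP
  have hmem (q : ENNReal) {h : Metric.sphere (0 : Euc d) 1 → ℝ} (hh : Continuous h) :
      MemLp h q (sphereMeasure d) :=
    hh.memLp_of_hasCompactSupport (HasCompactSupport.of_compactSpace _)
  -- Cauchy–Schwarz against the constant 1, whose L² norm is the factor √ω_{d-1}.
  have h := integral_mul_le_Lp_mul_Lq_of_nonneg (μ := sphereMeasure d) Real.HolderConjugate.two_two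
    (f := fun _ => (1 : ℝ)) (g := fun θ => ‖conjEval P (θ : Euc d)‖)
    (ae_of_all _ fun _ => zero_le_one) (ae_of_all _ fun _ => norm_nonneg _)
    (hmem _ continuous_const) (hmem _ hQ)
  simpa [h2, sphereArea, Real.sqrt_eq_rpow] using h

lemma norm_flCoeff_le {d : ℕ} {f : Euc d → ℂ} {r M : ℝ} (hr : 0 ≤ r)
    (hM : ∀ x : Euc d, ‖x‖ = r → ‖f x‖ ≤ M) (P : MvPolynomial (Fin d) ℂ) :
    ‖flCoeff f P r‖ ≤ M * ∫ θ, ‖conjEval P (θ : Euc d)‖ ∂(sphereMeasure d) := by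
  rw [← integral_const_mul]
  refine norm_integral_le_of_norm_le
    ((integrable_sphere (contDiff_conjEval P).continuous).norm.const_mul M) (ae_of_all _ fun θ => ?_)
  rw [norm_mul]
  exact mul_le_mul_of_nonneg_right (hM _ (by simp [norm_smul, hr])) (norm_nonneg _)

end Polyharmonic

theorem mainTheorem11 (d : ℕ) (hd : 2 ≤ d) (r₀ : ℝ) (r₁ : EReal) (hr₀ : 0 ≤ r₀)
    (hr : (r₀ : EReal) < r₁)
    (Y : (k : ℕ) → Fin (Polyharmonic.harmonicDim d k) → MvPolynomial (Fin d) ℂ)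
    (hY : Polyharmonic.IsSphericalBasis d Y)
    (f : Polyharmonic.Euc d → ℂ) (τ : ℝ) (hτ : 0 ≤ τ)
    (hf : Polyharmonic.IsPolyharmonicInf (Polyharmonic.annulus d r₀ r₁) τ f) :
    (∀ (k : ℕ) (l : Fin (Polyharmonic.harmonicDim d k)),
      ContDiffOn ℝ ∞ (Polyharmonic.flCoeff f (Y k l)) (Polyharmonic.radii r₀ r₁)) ∧
    ∀ a b : ℝ, Set.Icc a b ⊆ Polyharmonic.radii r₀ r₁ → ∀ ε : ℝ, 0 < ε →
      ∃ C : ℝ, 0 < C ∧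
        ∀ (k : ℕ) (l : Fin (Polyharmonic.harmonicDim d k)), ∀ r ∈ Set.Icc a b, ∀ p : ℕ,
          ‖((Polyharmonic.radialOp d k)^[p] (Polyharmonic.flCoeff f (Y k l))) r‖
            ≤ C * Real.sqrt (Polyharmonic.sphereArea d) * ((2 * p).factorial : ℝ)
              * (τ + ε) ^ (2 * p) := by
  refine ⟨fun k l => Polyharmonic.contDiffOn_flCoeff hr₀ hf.1 _, fun a b hab ε hε => ?_⟩
  have hK : IsCompact {x : Polyharmonic.Euc d | ‖x‖ ∈ Set.Icc a b} :=
    Metric.isCompact_of_isClosed_isBounded (isClosed_Icc.preimage continuous_norm)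
      ((Metric.isBounded_closedBall (x := 0) (r := b)).subset fun x hx => by simpa using hx.2)
  -- C is chosen from the shell and ε alone, before k and l enter; this is the uniformity claimed.
  obtain ⟨C, hC, hbound⟩ := hf.2 _ hK (fun x hx => hab hx) ε hε
  refine ⟨C, hC, fun k l r hrab p => ?_⟩
  have hP : Y k l ∈ Polyharmonic.harmonicPoly d k := by
    rw [← hY.span_eq k]
    exact Submodule.subset_span ⟨l, rfl⟩
  rw [Polyharmonic.radialOp_iterate_flCoeff hd hr₀ hf.1 hP p r (hab hrab)]
  refine (Polyharmonic.norm_flCoeff_le (hr₀.trans (hab hrab).1.le)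
    (fun x hx => hbound p x (by simpa [hx] using hrab)) (Y k l)).trans ?_
  have h1 := Polyharmonic.integral_norm_conjEval_le (by simpa using hY.orthonormal k l l)
  have h2 : 0 ≤ C * ((2 * p).factorial : ℝ) * (τ + ε) ^ (2 * p) := by positivity
  calc _ ≤ C * ((2 * p).factorial : ℝ) * (τ + ε) ^ (2 * p) * √(Polyharmonic.sphereArea d) :=
        mul_le_mul_of_nonneg_left h1 h2
    _ = _ := by ring
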